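/- By a *local field* we mean a field complete with respect to a non-trivial discrete valuation, with finite residue field. For a local field $L$, write $\mathcal{O}_L$ for its valuation ring and $\mathfrak{P}_L$ for the maximal ideal of $\mathcal{O}_L$. For a finite Galois extension $L/K$ of local fields and $i \ge 0$ put $$G_i(L/K) := \{\sigma \in \mathrm{Gal}(L/K) : (\sigma - 1)(\mathcal{O}_L) \subseteq \mathfrak{P}_L^{i+1}\}.$$ The extension $L/K$ is *weakly ramified* if $G_2(L/K)$ is trivial. It is *doubly split* if, with $I = G_0(L/K)$ and $W = G_1(L/K)$, there are subgroups $U, T, C$ of $\mathrm{Gal}(L/K)$, with $C \le I$, giving internal semi-direct product decompositions $\mathrm{Gal}(L/K) = I \rtimes U$, $\mathrm{Gal}(L/K) = W \rtimes T$, $I = W \rtimes C$ and $T = C \rtimes U$ (the first factor being normal in each). An element $\varepsilon$ is a *free generator* of $\mathfrak{P}_L^n$ over $\mathcal{O}_K[\mathrm{Gal}(L/K)]$ if $a \mapsto a\cdot\varepsilon$ is a bijection from $\mathcal{O}_K[\mathrm{Gal}(L/K)]$ onto $\mathfrak{P}_L^n$. **Theorem.** Let $L/K$ be a weakly ramified finite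 Galois extension of local fields and let $G = \mathrm{Gal}(L/K)$. Let $K'/K$ be the unramified extension of degree $[L:K]$ and let $L' = LK'$. Then $L'/K$ is a finite Galois extension that is weakly ramified and doubly split. Moreover, let $n \in \mathbb{Z}$ with $n \equiv 1 \bmod |G_1(L/K)|$, and let $\varepsilon' \in L'$ be any free generator of $\mathfrak{P}_{L'}^n$ over $\mathcal{O}_K[\mathrm{Gal}(L'/K)]$. Then $\varepsilon := \mathrm{Tr}_{L'/L}(\varepsilon')$ is a free generator of $\mathfrak{P}_L^n$ over $\mathcal{O}_K[G]$. -/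

import Mathlib

open ValuativeRel
open scoped nonZeroDivisors

namespace LocalGalois

section Extension

variable (K L : Type*) [Field K] [ValuativeRel K] [Field L] [ValuativeRel L] [Algebra K L]

/-- In an extension of valued fields, the valuation of `L` restricts to that of `K`. -/
instance hasExtension [ValuativeExtension K L] :
    (valuation K).HasExtension (valuation L) where
  val_isEquiv_comap := fun a b => by
    rw [Valuation.comap_apply, Valuation.comap_apply,
      ← (Valuation.Compatible.vle_iff_le (v := valuation K) a b),
      ← (Valuation.Compatible.vle_iff_le (v := valuation L) _ _),
      ValuativeExtension.vle_iff_vle]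

/-- An extension `L/K` of local fields is unramified: a uniformizer of `K` is still one of `L`
(i.e. `𝔓_K 𝒪_L = 𝔓_L`), and the residue field extension is separable. -/
def IsUnramified [TopologicalSpace K] [IsNonarchimedeanLocalField K]
    [TopologicalSpace L] [IsNonarchimedeanLocalField L] [ValuativeExtension K L] : Prop :=
  Ideal.map (algebraMap 𝒪[K] 𝒪[L]) 𝓂[K] = 𝓂[L] ∧ Algebra.IsSeparable 𝓀[K] 𝓀[L]

/-- The `i`-th ramification group in the lower numbering, `i ≥ 0`:
`G_i = {σ ∈ Gal(L/K) | (σ - 1)(𝒪_L) ⊆ 𝔓_L^{i+1}}`. -/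
def ramificationGroup (i : ℕ) : Subgroup Gal(L/K) where
  carrier := {σ | ∀ x : 𝒪[L], ∃ y ∈ 𝓂[L] ^ (i + 1), (y : L) = σ (x : L) - (x : L)}
  one_mem' := fun x => ⟨0, Ideal.zero_mem _, by simp⟩
  mul_mem' := by
    intro σ τ hσ hτ x
    obtain ⟨y, hy, hyx⟩ := hτ x
    obtain ⟨z, hz, hzx⟩ := hσ (x + y)
    refine ⟨z + y, Ideal.add_mem _ hz hy, ?_⟩
    have h : ((x + y : 𝒪[L]) : L) = τ (x : L) := by
      rw [Subring.coe_add, hyx]; ring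
    rw [Subring.coe_add, hzx, h, hyx, AlgEquiv.mul_apply]
    ring
  inv_mem' := by
    intro σ hσ x
    -- `σ⁻¹ x` is integral: otherwise its inverse `u` lies in `𝔓_L` while `σ u` does not
    have hint : σ⁻¹ (x : L) ∈ 𝒪[L] := by
      by_contra hx
      have hx' : 1 < valuation L (σ⁻¹ (x : L)) := not_le.mp hx
      have hlt : valuation L (σ⁻¹ (x : L))⁻¹ < 1 := by
        rw [map_inv₀]; exact inv_lt_one_of_one_lt₀ hx'
      obtain ⟨y, hy, hyu⟩ := hσ ⟨(σ⁻¹ (x : L))⁻¹, hlt.le⟩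
      have hy1 : valuation L (y : L) < 1 := by
        have hym : y ∈ 𝓂[L] := Ideal.pow_le_self (Nat.succ_ne_zero i) hy
        refine lt_of_le_of_ne y.2 fun h1 => ?_
        exact (IsLocalRing.mem_maximalIdeal y).mp hym
          ((Valuation.integer.integers (valuation L)).isUnit_of_one' h1)
      have hx0 : (x : L) ≠ 0 := by
        intro h0
        simp [h0] at hx'
      have hs : σ (σ⁻¹ (x : L))⁻¹ = (x : L)⁻¹ := by
        rw [map_inv₀, ← AlgEquiv.mul_apply, mul_inv_cancel, AlgEquiv.one_apply]
      have h1 : valuation L (x : L)⁻¹ < 1 := by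
        have : (x : L)⁻¹ = y + (σ⁻¹ (x : L))⁻¹ := by rw [hyu, hs]; ring
        rw [this]
        exact Valuation.map_add_lt _ hy1 hlt
      have h2 : valuation L (x : L) ≤ 1 := x.2
      rw [map_inv₀] at h1
      have h3 : 0 < valuation L (x : L) := by
        rw [zero_lt_iff]; simpa using hx0
      exact absurd h1 (not_lt.mpr ((one_le_inv₀ h3).mpr h2))
    obtain ⟨y, hy, hyx⟩ := hσ ⟨σ⁻¹ (x : L), hint⟩
    refine ⟨-y, Submodule.neg_mem _ hy, ?_⟩
    rw [Subring.coe_neg, hyx]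
    change -(σ (σ⁻¹ (x : L)) - σ⁻¹ (x : L)) = _
    rw [← AlgEquiv.mul_apply, mul_inv_cancel, AlgEquiv.one_apply]
    ring

/-- `L/K` is weakly ramified if its second ramification group is trivial. -/
def WeaklyRamified : Prop := ramificationGroup K L 2 = ⊥

end Extension

/-- The subgroup `A` of `G` is the internal semi-direct product `N ⋊ H` (with `N` normal in `A`). -/
def IsSemidirect {G : Type*} [Group G] (N H A : Subgroup G) : Prop :=
  N ≤ A ∧ H ≤ A ∧ (N.subgroupOf A).Normal ∧ N ⊓ H = ⊥ ∧ N ⊔ H = A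

/-- Let `I = G_0` be the inertia subgroup and `W = G_1` the wild inertia subgroup of
`G = Gal(L/K)`. Then `L/K` is doubly split if there are subgroups `U, T, C` of `G` such that
`G = I ⋊ U`, `G = W ⋊ T`, `I = W ⋊ C` and `T = C ⋊ U`. -/
def DoublySplit (K L : Type*) [Field K] [Field L] [ValuativeRel L] [Algebra K L] : Prop :=
  ∃ U T C : Subgroup Gal(L/K),
    IsSemidirect (ramificationGroup K L 0) U ⊤ ∧
    IsSemidirect (ramificationGroup K L 1) T ⊤ ∧
    IsSemidirect (ramificationGroup K L 1) C (ramificationGroup K L 0) ∧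
    IsSemidirect C U T

/-- The fractional ideal `𝔓_L^n` of `𝒪_L`, for `n : ℤ`. -/
noncomputable def primePow (L : Type*) [Field L] [ValuativeRel L] [TopologicalSpace L]
    [IsNonarchimedeanLocalField L] (n : ℤ) : FractionalIdeal 𝒪[L]⁰ L :=
  (𝓂[L] : FractionalIdeal 𝒪[L]⁰ L) ^ n

/-- The action of the group ring `𝒪_K[Gal(L/K)]` on `L`. -/
noncomputable def groupRingAction (K L : Type*) [Field K] [ValuativeRel K] [Field L]
    [Algebra K L] : MonoidAlgebra 𝒪[K] Gal(L/K) →ₐ[𝒪[K]] Module.End 𝒪[K] L :=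
  (Representation.ofDistribMulAction 𝒪[K] Gal(L/K) L).asAlgebraHom

/-- `ε` is a free generator of `M ⊆ L` over `𝒪_K[Gal(L/K)]`: the map `a ↦ a · ε` is a bijection
from `𝒪_K[Gal(L/K)]` onto `M`. -/
def IsFreeGenerator (K : Type*) {L : Type*} [Field K] [ValuativeRel K] [Field L]
    [Algebra K L] (M : Set L) (ε : L) : Prop :=
  Function.Injective (fun a => groupRingAction K L a ε) ∧
    Set.range (fun a => groupRingAction K L a ε) = M

end LocalGalois

/-! Everything follows from the fact that `L'/L` is unramified while `L'/K` has exponent dividing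
`[L:K] = [K':K]`.

An automorphism of `L'` that is trivial on `L` and on `K'` is trivial, and inertia fixes `K'`,
because `K'` is generated over `K` by Teichmüller representatives. Hence `L'/L` has trivial inertia,
and a degree count (`map_maximalIdeal_eq_of_inertia_eq_bot`) shows that a uniformizer of `L` remains
one in `L'`. So `G_2(L'/K)` restricts into `G_2(L/K) = 1` and vanishes.

For double splitting, put `I = G_0` and `W = G_1`. The tame character embeds `I/W` in the units of
the residue field; since `G_2 = 1`, the wild character embeds `W` in its additive group. Thus `W` is
abelian of order prime to that of the cyclic group `I/W`, which lifts to a subgroup `C`. A lift of a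
generator of the cyclic group `G/I` can be corrected by `W` so as to normalise `C`. It generates a
complement `U` of `I` because every element of `G` is killed by `[L:K]`, which divides `|G/I|`
(`exists_isSemidirect_of_character`).

For generators, the trace from `L'` to `L` intertwines the group ring actions through restriction,
which is surjective, and it maps `𝔓_{L'}^n` onto `𝔓_L^n` because `L'/L` is unramified. So `ε`
generates `𝔓_L^n`, and freeness follows by counting dimensions. -/

namespace LocalGalois

/-! ### Ideals and valuations in a single local field -/

section Basic

variable (F : Type*) [Field F] [ValuativeRel F] [TopologicalSpace F] [IsNonarchimedeanLocalField F]

theorem isAdicComplete_integer : IsAdicComplete 𝓂[F] 𝒪[F] :=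
  letI := IsTopologicalAddGroup.rightUniformSpace F
  haveI := isUniformAddGroup_of_addCommGroup (G := F)
  inferInstance

variable {F}

theorem mem_maximalIdeal_iff (y : 𝒪[F]) : y ∈ 𝓂[F] ↔ valuation F (y : F) < 1 := by
  rw [IsLocalRing.mem_maximalIdeal, mem_nonunits_iff,
    Valuation.Integer.not_isUnit_iff_valuation_lt_one]

omit [TopologicalSpace F] [IsNonarchimedeanLocalField F] in
theorem dvd_integer_iff (x y : 𝒪[F]) : x ∣ y ↔ valuation F (y : F) ≤ valuation F (x : F) :=
  (Valuation.integer.integers (valuation F)).dvd_iff_le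

theorem mem_maximalIdeal_pow_iff {ϖ : 𝒪[F]} (hϖ : Irreducible ϖ) (y : 𝒪[F]) (n : ℕ) :
    y ∈ 𝓂[F] ^ n ↔ valuation F (y : F) ≤ valuation F (ϖ : F) ^ n := by
  rw [hϖ.maximalIdeal_eq, Ideal.span_singleton_pow, Ideal.mem_span_singleton, dvd_integer_iff]
  simp

theorem valuation_lt_one_iff {ϖ : 𝒪[F]} (hϖ : Irreducible ϖ) (y : F) :
    valuation F y < 1 ↔ valuation F y ≤ valuation F (ϖ : F) := by
  constructor
  · intro h
    have := (mem_maximalIdeal_iff (F := F) ⟨y, h.le⟩).2 h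
    simpa using (mem_maximalIdeal_pow_iff hϖ ⟨y, h.le⟩ 1).1 (by simpa using this)
  · intro h
    exact h.trans_lt (Valuation.integer.v_irreducible_lt_one hϖ)

theorem exists_valuation_eq_zpow {ϖ : 𝒪[F]} (hϖ : Irreducible ϖ) {x : F} (hx : x ≠ 0) :
    ∃ n : ℤ, valuation F x = valuation F (ϖ : F) ^ n := by
  have key (y : F) (hy : y ≠ 0) (h : valuation F y ≤ 1) :
      ∃ n : ℕ, valuation F y = valuation F (ϖ : F) ^ n := by
    obtain ⟨n, u, hu⟩ := IsDiscreteValuationRing.eq_unit_mul_pow_irreducible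
      (x := (⟨y, h⟩ : 𝒪[F])) (by simpa [Subtype.ext_iff] using hy) hϖ
    refine ⟨n, ?_⟩
    have := congrArg (fun z : 𝒪[F] => valuation F (z : F)) hu
    have hu1 : valuation F ((u : 𝒪[F]) : F) = 1 :=
      (Valuation.integer.integers (valuation F)).valuation_unit u
    simpa [hu1] using this
  rcases le_total (valuation F x) 1 with h | h
  · obtain ⟨n, hn⟩ := key x hx h
    exact ⟨n, by simpa using hn⟩
  · obtain ⟨n, hn⟩ := key x⁻¹ (inv_ne_zero hx) (by
      rw [map_inv₀]; exact inv_le_one_of_one_le₀ h)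
    exact ⟨-n, by rw [zpow_neg, zpow_natCast, ← hn, map_inv₀, inv_inv]⟩

end Basic

theorem isPrecomplete_pi {R ι : Type*} [CommRing R] (I : Ideal R) [IsPrecomplete I R] [Finite ι] :
    IsPrecomplete I (ι → R) := by
  classical
  cases nonempty_fintype ι
  refine ⟨fun f hf => ?_⟩
  have hcomp (i : ι) : ∃ l : R, ∀ n, f n i ≡ l [SMOD (I ^ n • ⊤ : Submodule R R)] := by
    refine IsPrecomplete.prec' _ fun {m n} hmn => ?_
    have h := hf hmn
    rw [SModEq.sub_mem] at h ⊢
    have := Submodule.mem_map_of_mem (f := LinearMap.proj (R := R) (φ := fun _ : ι => R) i) h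
    rw [Submodule.map_smul''] at this
    exact Submodule.smul_mono le_rfl le_top this
  choose l hl using hcomp
  refine ⟨l, fun n => ?_⟩
  rw [SModEq.sub_mem, pi_eq_sum_univ' (f n - l)]
  refine Submodule.sum_mem _ fun i _ => ?_
  have := hl i n
  rw [SModEq.sub_mem] at this
  refine Submodule.smul_mem_smul ?_ trivial
  simpa using this

/-! ### Finiteness and integrality of the valuation ring extension -/

section Extension

variable (K L : Type*) [Field K] [ValuativeRel K] [TopologicalSpace K] [IsNonarchimedeanLocalField K]
  [Field L] [ValuativeRel L] [TopologicalSpace L] [IsNonarchimedeanLocalField L]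
  [Algebra K L] [ValuativeExtension K L]

theorem algebraMap_mem_maximalIdeal (x : 𝒪[K]) (hx : x ∈ 𝓂[K]) :
    algebraMap 𝒪[K] 𝒪[L] x ∈ 𝓂[L] := by
  rw [mem_maximalIdeal_iff] at hx ⊢
  exact (Valuation.HasExtension.val_map_lt_one_iff (valuation K) (valuation L) _).2 hx

theorem map_maximalIdeal_le : Ideal.map (algebraMap 𝒪[K] 𝒪[L]) 𝓂[K] ≤ 𝓂[L] :=
  Ideal.map_le_iff_le_comap.2 (algebraMap_mem_maximalIdeal K L)

theorem isHausdorff_integer : IsHausdorff 𝓂[K] 𝒪[L] := by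
  refine ⟨fun x hx => ?_⟩
  have := isAdicComplete_integer L
  refine IsHausdorff.haus' (I := 𝓂[L]) x fun n => ?_
  have := hx n
  rw [SModEq.zero] at this ⊢
  rw [Ideal.smul_top_eq_map, Submodule.restrictScalars_mem, Ideal.map_pow] at this
  simpa using Ideal.pow_right_mono (map_maximalIdeal_le K L) n this

omit [TopologicalSpace L] [IsNonarchimedeanLocalField L] in
theorem map_maximalIdeal_ne_bot : Ideal.map (algebraMap 𝒪[K] 𝒪[L]) 𝓂[K] ≠ ⊥ := by
  rw [Ne, Ideal.map_eq_bot_iff_of_injective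
    (Valuation.HasExtension.algebraMap_injective (vK := valuation K) (vA := valuation L))]
  exact IsDiscreteValuationRing.not_a_field 𝒪[K]

theorem finite_quotient_smul_top :
    Finite (𝒪[L] ⧸ (𝓂[K] • ⊤ : Submodule 𝒪[K] 𝒪[L])) := by
  obtain ⟨π, hπ⟩ := IsDiscreteValuationRing.exists_irreducible 𝒪[L]
  obtain ⟨n, hn⟩ := IsDiscreteValuationRing.ideal_eq_span_pow_irreducible
    (map_maximalIdeal_ne_bot K L) hπ
  rw [Ideal.smul_top_eq_map, hn, ← Ideal.span_singleton_pow, ← hπ.maximalIdeal_eq]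
  have : Finite (𝒪[L] ⧸ 𝓂[L]) := inferInstanceAs (Finite 𝓀[L])
  exact Ideal.finite_quotient_pow (IsNoetherian.noetherian 𝓂[L]) n

/-- Nakayama over a complete base: `𝒪[L]` is separated for the `𝓂[K]`-adic topology and finite
modulo `𝓂[K]`, so lifts of all its residues modulo `𝓂[K]` generate it. -/
theorem finite_integer : Module.Finite 𝒪[K] 𝒪[L] := by
  have := isHausdorff_integer K L
  have := isAdicComplete_integer K
  have := finite_quotient_smul_top K L
  have := Fintype.ofFinite (𝒪[L] ⧸ (𝓂[K] • ⊤ : Submodule 𝒪[K] 𝒪[L]))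
  have := isPrecomplete_pi (ι := 𝒪[L] ⧸ (𝓂[K] • ⊤ : Submodule 𝒪[K] 𝒪[L])) 𝓂[K]
  classical
  let f := Fintype.linearCombination 𝒪[K]
    (fun i : 𝒪[L] ⧸ (𝓂[K] • ⊤ : Submodule 𝒪[K] 𝒪[L]) => (Quotient.out i : 𝒪[L]))
  have hf : Function.Surjective f := surjective_of_mkQ_comp_surjective (I := 𝓂[K]) fun y => by
    refine ⟨Pi.single y 1, ?_⟩
    rw [LinearMap.comp_apply, Fintype.linearCombination_apply_single, one_smul]
    exact Quotient.out_eq y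
  exact Module.Finite.of_surjective f hf

/-- This makes the valuation ring of `L` intrinsic to the `K`-algebra `L`, which is the source of
Galois invariance and of compatibility in towers. -/
theorem isIntegral_iff_valuation_le_one (x : L) : IsIntegral 𝒪[K] x ↔ valuation L x ≤ 1 := by
  constructor
  · intro h
    exact (Valuation.integer.integers (valuation L)).isIntegral_iff_v_le_one.1
      (h.tower_top (A := 𝒪[L]))
  · intro h
    have := finite_integer K L
    exact (Algebra.IsIntegral.isIntegral (R := 𝒪[K]) (⟨x, h⟩ : 𝒪[L])).map
      (IsScalarTower.toAlgHom 𝒪[K] 𝒪[L] L)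

end Extension

/-! ### Invariance of the valuation under embeddings and automorphisms -/

section Tower

variable (K L M : Type*)
  [Field K] [ValuativeRel K] [TopologicalSpace K] [IsNonarchimedeanLocalField K]
  [Field L] [ValuativeRel L] [TopologicalSpace L] [IsNonarchimedeanLocalField L]
  [Field M] [ValuativeRel M] [TopologicalSpace M] [IsNonarchimedeanLocalField M]
  [Algebra K L] [ValuativeExtension K L] [Algebra K M] [ValuativeExtension K M]

theorem valuation_algHom_le_one_iff (f : L →ₐ[K] M) (x : L) :
    valuation M (f x) ≤ 1 ↔ valuation L x ≤ 1 := by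
  rw [← isIntegral_iff_valuation_le_one K, ← isIntegral_iff_valuation_le_one K]
  exact isIntegral_algHom_iff (f.restrictScalars 𝒪[K]) f.injective

/-- A tower of local fields over `K` is automatically a tower of valued fields. -/
theorem valuativeExtension_of_isScalarTower [Algebra L M] [IsScalarTower K L M] :
    ValuativeExtension L M := by
  have h : ((valuation M).comap (algebraMap L M)).IsEquiv (valuation L) := by
    rw [Valuation.isEquiv_iff_val_le_one]
    exact valuation_algHom_le_one_iff K L M (IsScalarTower.toAlgHom K L M) _
  refine ⟨fun a b => ?_⟩
  rw [(valuation M).vle_iff_le, (valuation L).vle_iff_le]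
  exact h a b

variable {K L}

theorem valuation_algEquiv_apply (σ : Gal(L/K)) (x : L) : valuation L (σ x) = valuation L x := by
  have hle (τ : Gal(L/K)) (x : L) : valuation L (τ x) ≤ 1 ↔ valuation L x ≤ 1 :=
    valuation_algHom_le_one_iff K L L (τ : L →ₐ[K] L) x
  have h (τ : Gal(L/K)) : ((valuation L).comap (τ : L →+* L)).IsEquiv (valuation L) := by
    rw [Valuation.isEquiv_iff_val_le_one]
    exact hle τ _
  obtain ⟨ϖ, hϖ⟩ := IsDiscreteValuationRing.exists_irreducible 𝒪[L]
  have hlt (τ : Gal(L/K)) : valuation L (τ ϖ) ≤ valuation L (ϖ : L) := by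
    rw [← valuation_lt_one_iff hϖ]
    exact (Valuation.isEquiv_iff_val_lt_one.1 (h τ)).2
      (Valuation.integer.v_irreducible_lt_one hϖ)
  -- Preserving integrality only gives an equivalent valuation. Equality of values comes from
  -- discreteness: `σ` and `σ⁻¹` both send the uniformizer to something no larger, so its value is
  -- fixed.
  have heq : valuation L (σ ϖ) = valuation L (ϖ : L) := by
    refine le_antisymm (hlt σ) ?_
    have h1 := (h σ (σ⁻¹ ϖ) ϖ).2 (hlt σ⁻¹)
    simp only [Valuation.comap_apply, RingHom.coe_coe] at h1
    rwa [← AlgEquiv.mul_apply, mul_inv_cancel, AlgEquiv.one_apply] at h1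
  rcases eq_or_ne x 0 with rfl | hx
  · simp
  obtain ⟨n, hn⟩ := exists_valuation_eq_zpow hϖ hx
  rw [← map_zpow₀] at hn
  have h1 := (Valuation.IsEquiv.eq_iff (h σ)).2 hn
  simp only [Valuation.comap_apply, RingHom.coe_coe] at h1
  rw [h1, hn, map_zpow₀, map_zpow₀, map_zpow₀, heq]

end Tower

/-! ### Teichmüller representatives -/

section Teichmuller

variable {F : Type*} [Field F] [ValuativeRel F] [TopologicalSpace F] [IsNonarchimedeanLocalField F]

theorem natCast_card_residueField_mem : ((Nat.card 𝓀[F] : ℕ) : 𝒪[F]) ∈ 𝓂[F] := by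
  rw [← Ideal.Quotient.eq_zero_iff_mem, map_natCast]
  have : Fintype 𝓀[F] := Fintype.ofFinite _
  rw [Nat.card_eq_fintype_card]
  exact FiniteField.cast_card_eq_zero 𝓀[F]

theorem isUnit_eval_derivative {q : ℕ} (hq : (q : 𝒪[F]) ∈ 𝓂[F]) (x : 𝒪[F]) :
    IsUnit ((Polynomial.X ^ q - Polynomial.X : Polynomial 𝒪[F]).derivative.eval x) := by
  rw [← IsLocalRing.notMem_maximalIdeal]
  intro h
  refine (IsLocalRing.maximalIdeal.isMaximal 𝒪[F]).ne_top ((Ideal.eq_top_iff_one _).2 ?_)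
  -- The derivative is `q x^(q-1) - 1`, so the difference formed here equals `1`.
  have h2 := Ideal.sub_mem _ (Ideal.mul_mem_right (x ^ (q - 1)) _ hq) h
  convert h2 using 1
  simp [Polynomial.derivative_X_pow]

/-- `X^q - X` has unit derivative everywhere, so distinct roots stay distinct modulo `𝓂[F]`. The
exponent `q` need not be the residue cardinality of `F`; that of a subfield is needed later. -/
theorem eq_of_pow_eq_self {q : ℕ} (hq : (q : 𝒪[F]) ∈ 𝓂[F]) {a b : 𝒪[F]} (ha : a ^ q = a)
    (hb : b ^ q = b) (hab : a - b ∈ 𝓂[F]) : a = b := by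
  refine IsLocalRing.eq_of_eval_eq_zero_of_not_isUnit_sub
    (f := (Polynomial.X ^ q - Polynomial.X : Polynomial 𝒪[F])) (by simp [ha]) (by simp [hb]) ?_
    (isUnit_eval_derivative hq a)
  simpa using hab

theorem exists_pow_card_eq_self (x : 𝒪[F]) :
    ∃ z : 𝒪[F], z ^ Nat.card 𝓀[F] = z ∧ z - x ∈ 𝓂[F] := by
  have := isAdicComplete_integer F
  have hq : 1 < Nat.card 𝓀[F] := Finite.one_lt_card
  have h0 : (Polynomial.X ^ (Nat.card 𝓀[F]) - Polynomial.X : Polynomial 𝒪[F]).eval x ∈ 𝓂[F] := by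
    rw [← IsLocalRing.residue_eq_zero_iff]
    have : Fintype 𝓀[F] := Fintype.ofFinite _
    have h := FiniteField.pow_card (IsLocalRing.residue 𝒪[F] x)
    rw [← Nat.card_eq_fintype_card] at h
    simpa [sub_eq_zero] using h
  obtain ⟨z, hz, hzx⟩ := HenselianRing.is_henselian (I := 𝓂[F]) _
    (Polynomial.monic_X_pow_sub (by simpa using hq)) x h0
    ((isUnit_eval_derivative natCast_card_residueField_mem x).map _)
  exact ⟨z, by simpa [sub_eq_zero] using hz, hzx⟩

end Teichmuller

/-! ### Unramified extensions are generated by Teichmüller representatives -/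

section Unramified

variable (K L : Type*) [Field K] [ValuativeRel K] [TopologicalSpace K] [IsNonarchimedeanLocalField K]
  [Field L] [ValuativeRel L] [TopologicalSpace L] [IsNonarchimedeanLocalField L]
  [Algebra K L] [ValuativeExtension K L]

/-- Nakayama: every integer is a Teichmüller representative modulo `𝓂[L]`, which equals `𝓂[K] 𝒪[L]`.
-/
theorem IsUnramified.adjoin_eq_top (h : IsUnramified K L) :
    Algebra.adjoin 𝒪[K] {z : 𝒪[L] | z ^ Nat.card 𝓀[L] = z} = ⊤ := by
  have := finite_integer K L
  rw [← Algebra.toSubmodule_eq_top]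
  rw [eq_top_iff]
  refine Submodule.le_of_le_smul_of_le_jacobson_bot (I := 𝓂[K]) (Module.Finite.fg_top) (IsLocalRing.maximalIdeal_le_jacobson _) ?_
  rw [Ideal.smul_top_eq_map, h.1]
  intro x _
  obtain ⟨z, hz, hzx⟩ := exists_pow_card_eq_self x
  rw [← sub_sub_cancel z x]
  exact Submodule.sub_mem _ (Submodule.mem_sup_left (Algebra.subset_adjoin hz))
    (Submodule.mem_sup_right hzx)

theorem IsUnramified.intermediateField_adjoin_eq_top (h : IsUnramified K L) :
    IntermediateField.adjoin K {z : L | z ^ Nat.card 𝓀[L] = z} = ⊤ := by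
  rw [eq_top_iff]
  have key (x : 𝒪[L]) : (x : L) ∈ IntermediateField.adjoin K {z : L | z ^ Nat.card 𝓀[L] = z} := by
    have hx : x ∈ Algebra.adjoin 𝒪[K] {z : 𝒪[L] | z ^ Nat.card 𝓀[L] = z} := by
      rw [IsUnramified.adjoin_eq_top K L h]; trivial
    induction hx using Algebra.adjoin_induction with
    | mem x hx =>
      refine IntermediateField.subset_adjoin K _ ?_
      have := congrArg (Subtype.val) (Set.mem_ofPred_eq ▸ hx)
      simpa using this
    | algebraMap r => exact IntermediateField.algebraMap_mem _ (r : K)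
    | add x y _ _ hx hy => exact add_mem hx hy
    | mul x y _ _ hx hy => exact mul_mem hx hy
  intro x _
  rcases le_total (valuation L x) 1 with hx | hx
  · exact key ⟨x, hx⟩
  · have := key ⟨x⁻¹, by rw [Valuation.mem_integer_iff, map_inv₀]; exact inv_le_one_of_one_le₀ hx⟩
    simpa using inv_mem this

/-- `L` is the splitting field of `X^q - X`: its residue classes provide `q` distinct roots, which
also forces separability. -/
theorem IsUnramified.isGalois (h : IsUnramified K L) : IsGalois K L := by
  classical
  set q := Nat.card 𝓀[L] with hq
  have hq1 : 1 < q := Finite.one_lt_card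
  let p : Polynomial K := Polynomial.X ^ q - Polynomial.X
  have hmon : (p.map (algebraMap K L)).Monic := (Polynomial.monic_X_pow_sub (by simpa using hq1)).map _
  have hdeg : (p.map (algebraMap K L)).natDegree = q := by
    rw [Polynomial.natDegree_map]
    exact FiniteField.X_pow_card_sub_X_natDegree_eq K hq1
  have hmem (z : L) : z ∈ (p.map (algebraMap K L)).roots ↔ z ^ q = z := by
    rw [Polynomial.mem_roots hmon.ne_zero]
    simp [p, sub_eq_zero]
  have hcard : q ≤ (p.map (algebraMap K L)).roots.toFinset.card := by
    choose t ht1 ht2 using fun x : 𝓀[L] => exists_pow_card_eq_self (Quotient.out x : 𝒪[L])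
    have hinj : Function.Injective fun x => (t x : L) := fun x y hxy => by
      have h1 := Ideal.sub_mem _ (ht2 y) (Subtype.ext hxy ▸ ht2 x)
      rw [sub_sub_sub_cancel_left, ← Ideal.Quotient.mk_eq_mk_iff_sub_mem] at h1
      exact (Quotient.out_eq x).symm.trans (h1.trans (Quotient.out_eq y))
    have := Fintype.ofFinite 𝓀[L]
    rw [hq, Nat.card_eq_fintype_card, ← Finset.card_univ,
      ← Finset.card_image_of_injective _ hinj]
    refine Finset.card_le_card fun z hz => ?_
    obtain ⟨x, -, rfl⟩ := Finset.mem_image.1 hz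
    rw [Multiset.mem_toFinset, hmem]
    exact_mod_cast congrArg Subtype.val (ht1 x)
  have hle := (Polynomial.card_roots' (p.map (algebraMap K L)))
  have hsplits : (p.map (algebraMap K L)).Splits := by
    rw [Polynomial.splits_iff_card_roots]
    exact le_antisymm hle (hdeg ▸ hcard.trans (Multiset.toFinset_card_le _))
  have hsep : p.Separable := by
    rw [← Polynomial.separable_map (algebraMap K L), ← Polynomial.nodup_roots_iff_of_splits hmon.ne_zero hsplits,
      ← Multiset.toFinset_card_eq_card_iff_nodup]
    exact le_antisymm (Multiset.toFinset_card_le _) (hle.trans (hdeg ▸ hcard))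
  have : p.IsSplittingField K L := by
    refine isSplittingField_iff_intermediateField.2 ⟨hsplits, ?_⟩
    rw [← IsUnramified.intermediateField_adjoin_eq_top K L h]
    congr 1
    ext z
    rw [Polynomial.mem_rootSet_of_ne (fun h0 => hmon.ne_zero (by simp [h0]))]
    simp [p, sub_eq_zero, q]
  exact IsGalois.of_separable_splitting_field hsep

end Unramified

/-! ### Galois action on integers and residues, and ramification groups -/

section Ramification

variable {K L : Type*} [Field K] [ValuativeRel K] [TopologicalSpace K] [IsNonarchimedeanLocalField K]
  [Field L] [ValuativeRel L] [TopologicalSpace L] [IsNonarchimedeanLocalField L]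
  [Algebra K L] [ValuativeExtension K L]

theorem algEquiv_apply_mem_integer (σ : Gal(L/K)) {x : L} (hx : x ∈ 𝒪[L]) : σ x ∈ 𝒪[L] := by
  rw [Valuation.mem_integer_iff, valuation_algEquiv_apply]
  exact hx

/-- The action of the Galois group on the valuation ring. -/
noncomputable def galInteger : Gal(L/K) →* (𝒪[L] ≃ₐ[𝒪[K]] 𝒪[L]) where
  toFun σ :=
    { toFun := fun x => ⟨σ x, algEquiv_apply_mem_integer σ x.2⟩
      invFun := fun x => ⟨σ.symm x, algEquiv_apply_mem_integer σ.symm x.2⟩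
      left_inv := fun x => Subtype.ext (σ.symm_apply_apply x)
      right_inv := fun x => Subtype.ext (σ.apply_symm_apply x)
      map_mul' := fun x y => Subtype.ext (map_mul σ (x : L) y)
      map_add' := fun x y => Subtype.ext (map_add σ (x : L) y)
      commutes' := fun r => Subtype.ext (σ.commutes (r : K)) }
  map_one' := rfl
  map_mul' _ _ := rfl

@[simp]
theorem coe_galInteger_apply (σ : Gal(L/K)) (x : 𝒪[L]) : (galInteger σ x : L) = σ (x : L) := rfl

/-- The action of the Galois group on the residue field. -/
noncomputable def galResidue : Gal(L/K) →* Gal(𝓀[L]/𝓀[K]) where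
  toFun σ :=
    { IsLocalRing.ResidueField.mapEquiv (galInteger σ).toRingEquiv with
      commutes' := fun r => by
        obtain ⟨r, rfl⟩ := IsLocalRing.residue_surjective r
        change IsLocalRing.residue 𝒪[L] (galInteger σ (algebraMap 𝒪[K] 𝒪[L] r)) = _
        rw [AlgEquiv.commutes]
        rfl }
  map_one' := by
    ext x
    obtain ⟨x, rfl⟩ := IsLocalRing.residue_surjective x
    rfl
  map_mul' σ τ := by
    ext x
    obtain ⟨x, rfl⟩ := IsLocalRing.residue_surjective x
    rfl

@[simp]
theorem galResidue_residue (σ : Gal(L/K)) (x : 𝒪[L]) :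
    galResidue σ (IsLocalRing.residue 𝒪[L] x) = IsLocalRing.residue 𝒪[L] (galInteger σ x) := rfl

theorem mem_ramificationGroup_iff' (σ : Gal(L/K)) (i : ℕ) :
    σ ∈ ramificationGroup K L i ↔ ∀ x : 𝒪[L], galInteger σ x - x ∈ 𝓂[L] ^ (i + 1) := by
  constructor
  · intro h x
    obtain ⟨y, hy, hyx⟩ := h x
    convert hy
    exact Subtype.ext hyx.symm
  · intro h x
    exact ⟨_, h x, rfl⟩

theorem mem_ramificationGroup_iff {ϖ : 𝒪[L]} (hϖ : Irreducible ϖ) (σ : Gal(L/K)) (i : ℕ) :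
    σ ∈ ramificationGroup K L i ↔
      ∀ x : 𝒪[L], valuation L (σ (x : L) - x) ≤ valuation L (ϖ : L) ^ (i + 1) := by
  simp_rw [mem_ramificationGroup_iff', mem_maximalIdeal_pow_iff hϖ]
  rfl

theorem ker_galResidue : (galResidue : Gal(L/K) →* Gal(𝓀[L]/𝓀[K])).ker =
    ramificationGroup K L 0 := by
  ext σ
  rw [mem_ramificationGroup_iff', MonoidHom.mem_ker, AlgEquiv.ext_iff,
    IsLocalRing.residue_surjective.forall]
  simp only [galResidue_residue, AlgEquiv.one_apply, zero_add, pow_one]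
  refine forall_congr' fun x => ?_
  rw [← IsLocalRing.residue_eq_zero_iff, map_sub, sub_eq_zero]

instance ramificationGroup_normal (i : ℕ) : (ramificationGroup K L i).Normal := by
  obtain ⟨ϖ, hϖ⟩ := IsDiscreteValuationRing.exists_irreducible 𝒪[L]
  refine ⟨fun σ hσ τ => ?_⟩
  rw [mem_ramificationGroup_iff hϖ] at hσ ⊢
  intro x
  have h := hσ (galInteger τ⁻¹ x)
  rw [coe_galInteger_apply, ← valuation_algEquiv_apply τ, map_sub, ← AlgEquiv.mul_apply τ τ⁻¹,
    mul_inv_cancel, AlgEquiv.one_apply] at h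
  exact h

theorem ramificationGroup_antitone : Antitone (ramificationGroup K L) := by
  intro i j hij σ hσ
  rw [mem_ramificationGroup_iff'] at hσ ⊢
  exact fun x => Ideal.pow_le_pow_right (by lia) (hσ x)

theorem galInteger_eq_self {q : ℕ} (hq : (q : 𝒪[L]) ∈ 𝓂[L]) {σ : Gal(L/K)}
    (hσ : σ ∈ ramificationGroup K L 0) {z : 𝒪[L]} (hz : z ^ q = z) : galInteger σ z = z := by
  refine eq_of_pow_eq_self hq (by rw [← map_pow, hz]) hz ?_
  simpa using (mem_ramificationGroup_iff' σ 0).1 hσ z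

/-- Within inertia only the uniformizer matters: Teichmüller representatives are fixed, so writing
`x = z - ϖ y` gains one power of `ϖ` over the bound already known for `y`. -/
theorem mem_ramificationGroup_of_uniformizer {ϖ : 𝒪[L]} (hϖ : Irreducible ϖ) {σ : Gal(L/K)}
    (hσ : σ ∈ ramificationGroup K L 0) {i : ℕ}
    (h : valuation L (σ (ϖ : L) - ϖ) ≤ valuation L (ϖ : L) ^ (i + 1)) :
    σ ∈ ramificationGroup K L i := by
  induction i with
  | zero => exact hσ
  | succ i ih =>
    have hi := ih (h.trans (pow_le_pow_right_of_le_one' ϖ.2 (by lia)))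
    rw [mem_ramificationGroup_iff hϖ] at hi ⊢
    intro x
    obtain ⟨z, hz, hzx⟩ := exists_pow_card_eq_self x
    rw [hϖ.maximalIdeal_eq, Ideal.mem_span_singleton] at hzx
    obtain ⟨y, hy⟩ := hzx
    have hzσ := congrArg Subtype.val (galInteger_eq_self natCast_card_residueField_mem hσ hz)
    rw [coe_galInteger_apply] at hzσ
    have hx : (x : L) = z - ϖ * y := by
      have := congrArg Subtype.val hy
      simp only [AddSubgroupClass.coe_sub, Subring.coe_mul] at this
      rw [← this]; ring
    have hsplit : σ (x : L) - x = -((σ ϖ - ϖ) * σ y + ϖ * (σ y - y)) := by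
      rw [hx, map_sub, hzσ, map_mul]; ring
    rw [hsplit, Valuation.map_neg]
    refine Valuation.map_add_le _ ?_ ?_
    · rw [map_mul, valuation_algEquiv_apply]
      exact (mul_le_of_le_one_right' y.2).trans h
    · rw [map_mul, pow_succ']
      exact mul_le_mul_right (hi y) _

end Ramification

/-! ### The tame and wild characters -/

section Tame

variable {K L : Type*} [Field K] [ValuativeRel K] [TopologicalSpace K] [IsNonarchimedeanLocalField K]
  [Field L] [ValuativeRel L] [TopologicalSpace L] [IsNonarchimedeanLocalField L]
  [Algebra K L] [ValuativeExtension K L]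

theorem residue_galInteger {σ : Gal(L/K)} (hσ : σ ∈ ramificationGroup K L 0) (x : 𝒪[L]) :
    IsLocalRing.residue 𝒪[L] (galInteger σ x) = IsLocalRing.residue 𝒪[L] x := by
  rw [← sub_eq_zero, ← map_sub, IsLocalRing.residue_eq_zero_iff]
  simpa using (mem_ramificationGroup_iff' σ 0).1 hσ x

/-- The character is the residue of `σ ϖ / ϖ`. This is a cocycle, and a homomorphism on residues
because inertia acts trivially there. -/
theorem exists_tameCharacter : ∃ θ : ramificationGroup K L 0 →* 𝓀[L]ˣ,
    ∀ σ, θ σ = 1 ↔ (σ : Gal(L/K)) ∈ ramificationGroup K L 1 := by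
  obtain ⟨ϖ, hϖ⟩ := IsDiscreteValuationRing.exists_irreducible 𝒪[L]
  have hϖ0 : (ϖ : L) ≠ 0 := by simpa using hϖ.ne_zero
  have hv0 : valuation L (ϖ : L) ≠ 0 := by simpa using hϖ0
  let u (σ : Gal(L/K)) : 𝒪[L] := ⟨σ ϖ / ϖ, by
    rw [Valuation.mem_integer_iff, map_div₀, valuation_algEquiv_apply, div_self hv0]⟩
  have hu (σ : Gal(L/K)) : (u σ : L) = σ ϖ / ϖ := rfl
  let θ : ramificationGroup K L 0 →* 𝓀[L] :=
    { toFun := fun σ => IsLocalRing.residue _ (u σ)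
      map_one' := by
        have : u 1 = 1 := Subtype.ext (by simp [hu, hϖ0])
        simp [this]
      map_mul' := fun σ τ => by
        have h : u (σ * τ) = galInteger (σ : Gal(L/K)) (u τ) * u σ := Subtype.ext (by
          simp only [Subring.coe_mul, coe_galInteger_apply, hu, map_div₀, AlgEquiv.mul_apply]
          have : (σ : Gal(L/K)) ϖ ≠ 0 := by simpa using hϖ0
          field_simp)
        rw [Subgroup.coe_mul, h, map_mul, residue_galInteger σ.2, mul_comm] }
  refine ⟨θ.toHomUnits, fun σ => ?_⟩
  rw [Units.ext_iff, MonoidHom.coe_toHomUnits, Units.val_one, ← sub_eq_zero]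
  change IsLocalRing.residue _ (u σ) - 1 = 0 ↔ _
  rw [← map_one (IsLocalRing.residue 𝒪[L]), ← map_sub, IsLocalRing.residue_eq_zero_iff,
    mem_maximalIdeal_iff, valuation_lt_one_iff hϖ]
  have h : (σ : Gal(L/K)) ϖ - ϖ = ϖ * ((u σ - 1 : 𝒪[L]) : L) := by
    rw [AddSubgroupClass.coe_sub, hu, Subring.coe_one]
    field_simp
  have hiff : valuation L ((u σ - 1 : 𝒪[L]) : L) ≤ valuation L (ϖ : L) ↔
      valuation L ((σ : Gal(L/K)) ϖ - ϖ) ≤ valuation L (ϖ : L) ^ (1 + 1) := by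
    rw [h, map_mul, pow_two, mul_le_mul_iff_right₀ (zero_lt_iff.2 hv0)]
  rw [hiff]
  exact ⟨mem_ramificationGroup_of_uniformizer hϖ σ.2,
    fun hσ => (mem_ramificationGroup_iff hϖ _ _).1 hσ ϖ⟩

/-- The character is the residue of `(σ ϖ - ϖ) / ϖ ^ 2`; modulo `ϖ` its cocycle relation becomes
additive. -/
theorem exists_wildCharacter : ∃ ψ : ramificationGroup K L 1 →* Multiplicative 𝓀[L],
    ∀ σ, ψ σ = 1 → (σ : Gal(L/K)) ∈ ramificationGroup K L 2 := by
  obtain ⟨ϖ, hϖ⟩ := IsDiscreteValuationRing.exists_irreducible 𝒪[L]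
  have hϖ0 : (ϖ : L) ≠ 0 := by simpa using hϖ.ne_zero
  have hv0 : valuation L (ϖ : L) ≠ 0 := by simpa using hϖ0
  let w (σ : ramificationGroup K L 1) : 𝒪[L] := ⟨((σ : Gal(L/K)) ϖ - ϖ) / ϖ ^ 2, by
    have := (mem_ramificationGroup_iff hϖ _ _).1 σ.2 ϖ
    rw [Valuation.mem_integer_iff, map_div₀, map_pow]
    exact div_le_one_of_le₀ this zero_le⟩
  have hw (σ : ramificationGroup K L 1) : (σ : Gal(L/K)) ϖ = ϖ + (w σ : L) * ϖ ^ 2 := by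
    simp only [w]
    field_simp
    ring
  let ψ : ramificationGroup K L 1 →* Multiplicative 𝓀[L] :=
    { toFun := fun σ => Multiplicative.ofAdd (IsLocalRing.residue _ (w σ))
      map_one' := by
        have : w 1 = 0 := Subtype.ext (by simp [w])
        simp [this]
      map_mul' := fun σ τ => by
        have h : w (σ * τ) = w σ + galInteger (σ : Gal(L/K)) (w τ) * (1 + w σ * ϖ) ^ 2 :=
          Subtype.ext (by
            have h1 := hw (σ * τ)
            rw [Subgroup.coe_mul, AlgEquiv.mul_apply, hw τ, map_add, map_mul, map_pow, hw σ] at h1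
            simp only [Subring.coe_add, Subring.coe_mul, Subring.coe_pow, Subring.coe_one,
              coe_galInteger_apply]
            have h2 : (ϖ : L) ^ 2 ≠ 0 := pow_ne_zero _ hϖ0
            apply mul_right_cancel₀ h2
            linear_combination -h1)
        have hr : IsLocalRing.residue 𝒪[L] ϖ = 0 := by
          rw [IsLocalRing.residue_eq_zero_iff, hϖ.maximalIdeal_eq]
          exact Ideal.mem_span_singleton_self ϖ
        rw [← ofAdd_add]
        congr 1
        rw [h, map_add, map_mul,
          residue_galInteger (ramificationGroup_antitone zero_le_one σ.2), map_pow, map_add,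
          map_mul, hr]
        simp }
  refine ⟨ψ, fun σ hσ => ?_⟩
  have h0 : IsLocalRing.residue 𝒪[L] (w σ) = 0 := hσ
  rw [IsLocalRing.residue_eq_zero_iff, mem_maximalIdeal_iff, valuation_lt_one_iff hϖ] at h0
  refine mem_ramificationGroup_of_uniformizer hϖ (ramificationGroup_antitone zero_le_one σ.2) ?_
  rw [hw σ, add_sub_cancel_left, map_mul, map_pow, pow_succ' _ 2]
  exact mul_le_mul_left h0 _

end Tame

/-! ### Splitting by coprimality -/

section GroupTheory

variable {G : Type*} [Group G]

/-- Two elements of order prime to `W` that agree modulo a commutative normal subgroup `W`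
are conjugate under `W`. -/
theorem exists_conj_eq_of_coprime (W : Subgroup G) [W.Normal]
    (hcomm : ∀ x ∈ W, ∀ y ∈ W, x * y = y * x) {a : ℕ} (ha : (Nat.card W).Coprime a)
    {c d : G} (hc : c ^ a = 1) (hd : d ^ a = 1) (hdc : d * c⁻¹ ∈ W) :
    ∃ w ∈ W, w * c * w⁻¹ = d := by
  have hq : (d : G ⧸ W) = c := by
    rw [QuotientGroup.eq_iff_div_mem, div_eq_mul_inv]
    exact hdc
  have hpow (n : ℕ) : d ^ n * (c ^ n)⁻¹ ∈ W := by
    rw [← div_eq_mul_inv, ← QuotientGroup.eq_iff_div_mem, QuotientGroup.mk_pow,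
      QuotientGroup.mk_pow, hq]
  have hcd : c * d⁻¹ ∈ W := by simpa using inv_mem hdc
  -- The averaging argument for vanishing of `H¹`: `f` is the product over `i < n` of the cocycle
  -- values `d ^ i * (c ^ i)⁻¹`.
  have key (n : ℕ) : ∃ f ∈ W, d * f * d⁻¹ = f * (d ^ n * (c ^ n)⁻¹) * (c * d⁻¹) ^ n := by
    induction n with
    | zero => exact ⟨1, one_mem _, by simp⟩
    | succ n ih =>
      obtain ⟨f, hf, h⟩ := ih
      refine ⟨f * (d ^ n * (c ^ n)⁻¹), mul_mem hf (hpow n), ?_⟩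
      calc d * (f * (d ^ n * (c ^ n)⁻¹)) * d⁻¹
          = (d * f * d⁻¹) * (d ^ (n + 1) * (c ^ (n + 1))⁻¹) * (c * d⁻¹) := by
            rw [pow_succ' d, pow_succ' c]; group
        _ = f * (d ^ n * (c ^ n)⁻¹) * ((c * d⁻¹) ^ n * (d ^ (n + 1) * (c ^ (n + 1))⁻¹)) *
              (c * d⁻¹) := by rw [h]; simp only [mul_assoc]
        _ = _ := by
            rw [hcomm _ (pow_mem hcd n) _ (hpow (n + 1)), pow_succ (c * d⁻¹)]
            simp only [mul_assoc]
  obtain ⟨f, hf, h⟩ := key a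
  rw [hc, hd, inv_one, mul_one, mul_one] at h
  -- At `n = a` the middle factor is trivial. Since `a`-th powers are bijective on `W`, a root `w`
  -- of `f` satisfies `d w d⁻¹ = w c d⁻¹`, that is, `d w = w c`.
  obtain ⟨w, hw⟩ := (powCoprime ha).surjective ⟨f, hf⟩
  have hwf : (w : G) ^ a = f := congrArg Subtype.val hw
  have hconj : d * w * d⁻¹ ∈ W := ‹W.Normal›.conj_mem _ w.2 d
  have heq : (⟨d * w * d⁻¹, hconj⟩ : W) = ⟨w * (c * d⁻¹), mul_mem w.2 hcd⟩ := by
    apply (powCoprime ha).injective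
    apply Subtype.ext
    change (d * w * d⁻¹) ^ a = (w * (c * d⁻¹)) ^ a
    rw [conj_pow, hwf, h, Commute.mul_pow (hcomm _ w.2 _ hcd), hwf]
  refine ⟨w, w.2, ?_⟩
  have := congrArg Subtype.val heq
  simp only [← mul_assoc, mul_left_inj] at this
  rw [← this, mul_inv_cancel_right]

theorem exists_isSemidirect_of_character [Finite G] {A : Type*} [CommGroup A] [IsCyclic A] [Finite A]
    (I W : Subgroup G) [I.Normal] [W.Normal] (θ : I →* A)
    (hθ : ∀ x : I, θ x = 1 ↔ (x : G) ∈ W) (hWI : W ≤ I)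
    (hcomm : ∀ x ∈ W, ∀ y ∈ W, x * y = y * x) (hcop : (Nat.card W).Coprime (Nat.card A))
    (hcyc : IsCyclic (G ⧸ I)) (hexp : ∀ g : G, g ^ I.index = 1) :
    ∃ U T C : Subgroup G, IsSemidirect I U ⊤ ∧ IsSemidirect W T ⊤ ∧ IsSemidirect W C I ∧
      IsSemidirect C U T := by
  obtain ⟨c, hcI, hca, hgen⟩ : ∃ c ∈ I, c ^ Nat.card A = 1 ∧
      ∀ x ∈ I, ∃ j : ℤ, x * (c ^ j)⁻¹ ∈ W := by
    obtain ⟨⟨_, c₀, rfl⟩, hc₀⟩ := IsCyclic.exists_generator (α := θ.range)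
    -- With `k ≡ 1` modulo `|A|` and `k ≡ 0` modulo `|W|`, the power `c₀ ^ k` keeps its image under
    -- `θ` but is now killed by `|A|`.
    obtain ⟨k, hkA, hkW⟩ := Nat.chineseRemainder hcop.symm 1 0
    have hθk : θ (c₀ ^ k) = θ c₀ := by
      conv_rhs => rw [← pow_one (θ c₀)]
      rw [map_pow, pow_eq_pow_iff_modEq]
      exact hkA.of_dvd (orderOf_dvd_natCard _)
    refine ⟨(c₀ ^ k : I), SetLike.coe_mem _, ?_, fun x hx => ?_⟩
    · obtain ⟨t, rfl⟩ := (Nat.modEq_zero_iff_dvd).1 hkW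
      have h1 : ((c₀ ^ Nat.card A : I) : G) ∈ W := by
        rw [← hθ, map_pow, pow_card_eq_one']
      have h2 := pow_card_eq_one' (x := (⟨_, h1⟩ : W))
      have h3 : ((c₀ : G) ^ Nat.card A) ^ Nat.card W = 1 := congrArg Subtype.val h2
      rw [Subgroup.coe_pow, ← pow_mul, mul_comm, ← mul_assoc, pow_mul, pow_mul, h3, one_pow]
    · obtain ⟨j, hj⟩ := hc₀ ⟨θ ⟨x, hx⟩, _, rfl⟩
      refine ⟨j, ?_⟩
      have : ((⟨x, hx⟩ * ((c₀ ^ k) ^ j)⁻¹ : I) : G) ∈ W := by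
        rw [← hθ, map_mul, map_inv, map_zpow, hθk, mul_inv_eq_one]
        exact (congrArg Subtype.val hj).symm
      simpa using this
  obtain ⟨s, hs⟩ := hcyc.exists_generator
  obtain ⟨σ, rfl⟩ := QuotientGroup.mk_surjective s
  obtain ⟨j, hj⟩ := hgen (σ * c * σ⁻¹) (‹I.Normal›.conj_mem _ hcI σ)
  obtain ⟨w, hw, hwc⟩ := exists_conj_eq_of_coprime W hcomm hcop (c := c ^ j)
    (d := σ * c * σ⁻¹) (by rw [← zpow_natCast, zpow_comm, zpow_natCast, hca, one_zpow])
    (by rw [conj_pow, hca]; simp) hj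
  -- The conjugate `σ c σ⁻¹` agrees with `c ^ j` modulo `W`, hence is `W`-conjugate to it; the
  -- correction by `w` makes `τ` normalise `⟨c⟩` without changing its class modulo `I`.
  set τ := w⁻¹ * σ with hτ
  have hτσ : (τ : G ⧸ I) = σ := by
    rw [hτ, QuotientGroup.mk_mul, (QuotientGroup.eq_one_iff _).2 (inv_mem (hWI hw)), one_mul]
  have hτc : τ * c * τ⁻¹ = c ^ j := by
    rw [hτ, mul_inv_rev, inv_inv]
    calc w⁻¹ * σ * c * (σ⁻¹ * w) = w⁻¹ * (σ * c * σ⁻¹) * w := by group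
      _ = c ^ j := by rw [← hwc]; group
  set C := Subgroup.zpowers c
  set U := Subgroup.zpowers τ
  have hCI : C ≤ I := by simpa [C] using hcI
  have hUC : U ≤ Subgroup.normalizer (C : Set G) := by
    rw [Subgroup.zpowers_le]
    refine Subgroup.mem_normalizer_fintype fun x hx => ?_
    obtain ⟨i, rfl⟩ := Subgroup.mem_zpowers_iff.1 hx
    rw [SetLike.mem_coe, ← conj_zpow, hτc]
    exact zpow_mem (zpow_mem (Subgroup.mem_zpowers c) j) i
  have hIU : I ⊓ U = ⊥ := by
    rw [eq_bot_iff]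
    rintro x ⟨hxI, hxU⟩
    obtain ⟨m, rfl⟩ := Subgroup.mem_zpowers_iff.1 hxU
    have h1 : ((σ : G ⧸ I)) ^ m = 1 := by
      rw [← hτσ, ← QuotientGroup.mk_zpow]
      exact (QuotientGroup.eq_one_iff _).2 hxI
    rw [← orderOf_dvd_iff_zpow_eq_one, orderOf_eq_card_of_forall_mem_zpowers hs] at h1
    obtain ⟨t, rfl⟩ := h1
    rw [Subgroup.mem_bot, zpow_mul, zpow_natCast]
    -- The exponent hypothesis makes the order of `τ` no larger than that of its image in `G/I`.
    change (τ ^ I.index) ^ t = 1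
    rw [hexp, one_zpow]
  have hIUtop : I ⊔ U = ⊤ := by
    rw [eq_top_iff]
    intro g _
    obtain ⟨m, hm⟩ := hs g
    have h1 : (g * (τ ^ m)⁻¹) ∈ I := by
      rw [← QuotientGroup.eq_one_iff, QuotientGroup.mk_mul, QuotientGroup.mk_inv,
        QuotientGroup.mk_zpow, hτσ, mul_inv_eq_one]
      exact hm.symm
    rw [← inv_mul_cancel_right g (τ ^ m)]
    exact mul_mem (Subgroup.mem_sup_left h1)
      (Subgroup.mem_sup_right (zpow_mem (Subgroup.mem_zpowers τ) m))
  have hWC : W ⊓ C = ⊥ := by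
    refine disjoint_iff.1 (Subgroup.disjoint_of_coprime_natCard (hcop.coprime_dvd_right ?_))
    rw [Nat.card_zpowers]
    exact orderOf_dvd_of_pow_eq_one hca
  have hWCI : W ⊔ C = I := by
    refine le_antisymm (sup_le hWI hCI) fun x hx => ?_
    obtain ⟨i, hi⟩ := hgen x hx
    rw [← inv_mul_cancel_right x (c ^ i)]
    exact mul_mem (Subgroup.mem_sup_left hi)
      (Subgroup.mem_sup_right (zpow_mem (Subgroup.mem_zpowers c) i))
  refine ⟨U, C ⊔ U, C, ⟨le_top, le_top, inferInstance, hIU, hIUtop⟩,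
    ⟨le_top, le_top, inferInstance, ?_, ?_⟩, ⟨hWI, hCI, inferInstance, hWC, hWCI⟩,
    ⟨le_sup_left, le_sup_right, ?_, ?_, rfl⟩⟩
  · rw [eq_bot_iff]
    rintro x ⟨hxW, hxT⟩
    replace hxT : x ∈ ((C ⊔ U : Subgroup G) : Set G) := hxT
    rw [Subgroup.coe_mul_of_right_le_normalizer_left _ _ hUC] at hxT
    obtain ⟨y, hy, z, hz, rfl⟩ := hxT
    have hz1 : z ∈ I ⊓ U := ⟨(Subgroup.mul_mem_cancel_left _ (hCI hy)).1 (hWI hxW), hz⟩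
    rw [hIU, Subgroup.mem_bot] at hz1
    subst hz1
    rw [← hWC]
    exact ⟨hxW, by simpa using hy⟩
  · rw [← sup_assoc, hWCI, hIUtop]
  · rw [Subgroup.normal_subgroupOf_iff_le_normalizer le_sup_left]
    exact sup_le Subgroup.le_normalizer hUC
  · rw [eq_bot_iff, ← hIU]
    exact inf_le_inf_right _ hCI

end GroupTheory

/-! ### Double splitting of weakly ramified extensions -/

section Splitting

variable {K L : Type*} [Field K] [ValuativeRel K] [TopologicalSpace K] [IsNonarchimedeanLocalField K]
  [Field L] [ValuativeRel L] [TopologicalSpace L] [IsNonarchimedeanLocalField L]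
  [Algebra K L] [ValuativeExtension K L]

theorem isCyclic_quotient_of_ker_eq {G H : Type*} [Group G] [Group H] [IsCyclic H] (f : G →* H)
    (N : Subgroup G) [N.Normal] (h : f.ker = N) : IsCyclic (G ⧸ N) := by
  subst h
  exact isCyclic_of_injective (QuotientGroup.kerLift f) (QuotientGroup.kerLift_injective f)

theorem isCyclic_quotient_inertia : IsCyclic (Gal(L/K) ⧸ ramificationGroup K L 0) :=
  isCyclic_quotient_of_ker_eq galResidue _ ker_galResidue

theorem WeaklyRamified.doublySplit [FiniteDimensional K L] (h : WeaklyRamified K L)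
    (hexp : ∀ σ : Gal(L/K), σ ^ (ramificationGroup K L 0).index = 1) : DoublySplit K L := by
  obtain ⟨θ, hθ⟩ := exists_tameCharacter (K := K) (L := L)
  obtain ⟨ψ, hψ⟩ := exists_wildCharacter (K := K) (L := L)
  have hinj : Function.Injective ψ := by
    rw [injective_iff_map_eq_one]
    intro σ hσ
    have := hψ σ hσ
    rw [h, Subgroup.mem_bot] at this
    exact Subtype.ext this
  refine exists_isSemidirect_of_character _ _ θ hθ (ramificationGroup_antitone zero_le_one)
    (fun x hx y hy => ?_) ?_ isCyclic_quotient_inertia hexp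
  · have : (⟨x, hx⟩ * ⟨y, hy⟩ : ramificationGroup K L 1) = ⟨y, hy⟩ * ⟨x, hx⟩ :=
      hinj (by rw [map_mul, map_mul, mul_comm])
    exact congrArg Subtype.val this
  -- `|W|` divides the residue cardinality `q`, while the tame character takes values in a group of
  -- order `q - 1`.
  · have hdvd : Nat.card (ramificationGroup K L 1) ∣ Nat.card 𝓀[L] :=
      (Subgroup.card_dvd_of_injective ψ hinj).trans
        (Nat.card_congr (Multiplicative.toAdd (α := 𝓀[L]))).dvd
    refine Nat.Coprime.coprime_dvd_left hdvd ?_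
    rw [Nat.card_units]
    exact (Nat.coprime_self_sub_right Nat.card_pos).2 (Nat.coprime_one_right _)

end Splitting

/-! ### Inertia and unramified subextensions -/

section Inertia

variable {K K' L : Type*}
  [Field K] [ValuativeRel K] [TopologicalSpace K] [IsNonarchimedeanLocalField K]
  [Field K'] [ValuativeRel K'] [TopologicalSpace K'] [IsNonarchimedeanLocalField K']
  [Field L] [ValuativeRel L] [TopologicalSpace L] [IsNonarchimedeanLocalField L]
  [Algebra K L] [ValuativeExtension K L] [Algebra K K'] [ValuativeExtension K K']
  [Algebra K' L] [IsScalarTower K K' L]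

/-- Inertia fixes every unramified subextension. -/
theorem IsUnramified.apply_algebraMap_eq_self (h : IsUnramified K K') {σ : Gal(L/K)}
    (hσ : σ ∈ ramificationGroup K L 0) (x : K') :
    σ (algebraMap K' L x) = algebraMap K' L x := by
  have := valuativeExtension_of_isScalarTower K K' L
  set q := Nat.card 𝓀[K']
  have hq : (q : 𝒪[L]) ∈ 𝓂[L] := by
    simpa using algebraMap_mem_maximalIdeal K' L _ (natCast_card_residueField_mem (F := K'))
  have hq1 : 1 < q := Finite.one_lt_card
  let f : K' →ₐ[K] L := (σ : L →ₐ[K] L).comp (IsScalarTower.toAlgHom K K' L)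
  have hfg : f = IsScalarTower.toAlgHom K K' L := by
    ext x
    have hx : x ∈ IntermediateField.adjoin K {z : K' | z ^ q = z} := by
      rw [IsUnramified.intermediateField_adjoin_eq_top K K' h]
      trivial
    induction hx using IntermediateField.adjoin_induction with
    | mem z hz =>
      replace hz : z ^ q = z := hz
      have hzint : valuation L (algebraMap K' L z) ≤ 1 := by
        by_contra! h1
        have h2 := congrArg (fun y => valuation L (algebraMap K' L y)) hz
        rw [map_pow, map_pow] at h2
        exact (lt_self_pow₀ h1 hq1).ne' h2
      have hzq : (⟨algebraMap K' L z, hzint⟩ : 𝒪[L]) ^ q = ⟨algebraMap K' L z, hzint⟩ :=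
        Subtype.ext (by simp [← map_pow, hz])
      exact congrArg Subtype.val (galInteger_eq_self hq hσ hzq)
    | algebraMap r => rw [AlgHom.commutes, AlgHom.commutes]
    | add x y _ _ hx hy => rw [map_add, map_add, hx, hy]
    | mul x y _ _ hx hy => rw [map_mul, map_mul, hx, hy]
    | inv x _ hx => rw [map_inv₀, map_inv₀, hx]
  exact DFunLike.congr_fun hfg x

end Inertia

/-! ### Trivial inertia and surjectivity of the trace -/

section Unramified

variable {K L : Type*} [Field K] [ValuativeRel K] [TopologicalSpace K] [IsNonarchimedeanLocalField K]
  [Field L] [ValuativeRel L] [TopologicalSpace L] [IsNonarchimedeanLocalField L]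
  [Algebra K L] [ValuativeExtension K L]

theorem isIntegralClosure_integer : IsIntegralClosure 𝒪[L] 𝒪[K] L where
  algebraMap_injective := Subtype.val_injective
  isIntegral_iff {x} := by
    rw [isIntegral_iff_valuation_le_one]
    exact ⟨fun h => ⟨⟨x, h⟩, rfl⟩, by rintro ⟨y, rfl⟩; exact y.2⟩

/-- A Galois extension with trivial inertia is unramified. -/
theorem map_maximalIdeal_eq_of_inertia_eq_bot [FiniteDimensional K L] [IsGalois K L] (h : ramificationGroup K L 0 = ⊥) :
    Ideal.map (algebraMap 𝒪[K] 𝒪[L]) 𝓂[K] = 𝓂[L] := by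
  have := finite_integer K L
  have : Module.Free 𝒪[K] 𝒪[L] := Module.free_of_finite_type_torsion_free'
  have hdeg : Module.finrank K L ≤ Module.finrank 𝓀[K] 𝓀[L] := by
    have hinj : Function.Injective (galResidue : Gal(L/K) →* Gal(𝓀[L]/𝓀[K])) := by
      rw [← MonoidHom.ker_eq_bot_iff, ker_galResidue, h]
    rw [← IsGalois.card_aut_eq_finrank]
    exact (Nat.card_le_card_of_injective _ hinj).trans
      ((Nat.card_congr (Algebra.IsAlgebraic.algEquivEquivAlgHom 𝓀[K] 𝓀[L]).toEquiv).trans_le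
        (card_algHom_le_finrank 𝓀[K] 𝓀[L] 𝓀[L]))
  let _ : Field (𝒪[K] ⧸ 𝓂[K]) := Ideal.Quotient.field _
  -- `𝒪[L]/𝓂[K]𝒪[L]` has dimension `[L:K]`, which is at most the residue degree, so its surjection
  -- onto `𝓀[L]` is bijective.
  have hrank : Module.finrank (𝒪[K] ⧸ 𝓂[K]) (𝒪[L] ⧸ Ideal.map (algebraMap 𝒪[K] 𝒪[L]) 𝓂[K]) =
      Module.finrank K L := by
    rw [IsLocalRing.finrank_quotient_map]
    exact (IsFractionRing.finrank_eq 𝒪[K] K 𝒪[L] L).symm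
  have : Finite (𝒪[K] ⧸ 𝓂[K]) := inferInstanceAs (Finite 𝓀[K])
  have : Finite (𝒪[L] ⧸ Ideal.map (algebraMap 𝒪[K] 𝒪[L]) 𝓂[K]) :=
    Module.finite_of_finite (𝒪[K] ⧸ 𝓂[K])
  have hcard : Nat.card (𝒪[L] ⧸ Ideal.map (algebraMap 𝒪[K] 𝒪[L]) 𝓂[K]) ≤ Nat.card 𝓀[L] := by
    rw [Module.natCard_eq_pow_finrank (K := 𝒪[K] ⧸ 𝓂[K]), hrank,
      Module.natCard_eq_pow_finrank (K := 𝓀[K]) (V := 𝓀[L])]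
    exact Nat.pow_le_pow_right Nat.card_pos hdeg
  have hbij := (Ideal.Quotient.factor_surjective (map_maximalIdeal_le K L)).bijective_of_nat_card_le
    hcard
  refine le_antisymm (map_maximalIdeal_le K L) fun x hx => ?_
  rw [← Ideal.Quotient.eq_zero_iff_mem]
  apply hbij.1
  rw [Ideal.Quotient.factor_mk, map_zero, Ideal.Quotient.eq_zero_iff_mem]
  exact hx

variable [FiniteDimensional K L]

theorem trace_integer [Module.Free 𝒪[K] 𝒪[L]] [Module.Finite 𝒪[K] 𝒪[L]] (y : 𝒪[L]) :
    Algebra.trace K L (y : L) = (Algebra.trace 𝒪[K] 𝒪[L] y : K) := by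
  have := isIntegralClosure_integer (K := K) (L := L)
  have := IsIntegralClosure.isLocalization 𝒪[K] K L 𝒪[L]
  exact Algebra.trace_localization 𝒪[K] 𝒪[K]⁰ y

theorem exists_trace_integer_eq (h : Ideal.map (algebraMap 𝒪[K] 𝒪[L]) 𝓂[K] = 𝓂[L]) (x : 𝒪[K]) :
    ∃ y : 𝒪[L], Algebra.trace K L (y : L) = x := by
  have := finite_integer K L
  have : Module.Free 𝒪[K] 𝒪[L] := Module.free_of_finite_type_torsion_free'
  -- One integer of unit trace suffices, by scaling. It exists because the trace reduces to that of
  -- an extension of finite fields, which is surjective.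
  suffices hs : ∃ y : 𝒪[L], IsUnit (Algebra.trace 𝒪[K] 𝒪[L] y) by
    obtain ⟨y, u, hu⟩ := hs
    refine ⟨(x * (u⁻¹ : 𝒪[K]ˣ)) • y, ?_⟩
    rw [trace_integer, map_smul, ← hu, smul_eq_mul, mul_assoc, Units.inv_mul, mul_one]
  let _ : Field (𝒪[K] ⧸ 𝓂[K]) := Ideal.Quotient.field _
  have : Finite (𝒪[K] ⧸ 𝓂[K]) := inferInstanceAs (Finite 𝓀[K])
  have : (Ideal.map (algebraMap 𝒪[K] 𝒪[L]) 𝓂[K]).IsMaximal := by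
    rw [h]; exact IsLocalRing.maximalIdeal.isMaximal _
  let _ : Field (𝒪[L] ⧸ Ideal.map (algebraMap 𝒪[K] 𝒪[L]) 𝓂[K]) := Ideal.Quotient.field _
  have : Module.Finite (𝒪[K] ⧸ 𝓂[K]) (𝒪[L] ⧸ Ideal.map (algebraMap 𝒪[K] 𝒪[L]) 𝓂[K]) :=
    Module.Finite.of_restrictScalars_finite 𝒪[K] _ _
  obtain ⟨y, hy⟩ := Algebra.trace_surjective (𝒪[K] ⧸ 𝓂[K])
    (𝒪[L] ⧸ Ideal.map (algebraMap 𝒪[K] 𝒪[L]) 𝓂[K]) 1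
  obtain ⟨y, rfl⟩ := Ideal.Quotient.mk_surjective y
  refine ⟨y, ?_⟩
  rw [← IsLocalRing.notMem_maximalIdeal, ← Ideal.Quotient.eq_zero_iff_mem,
    ← Algebra.trace_quotient_mk]
  exact hy.trans_ne one_ne_zero

end Unramified

/-! ### Fractional powers of the maximal ideal -/

section PrimePow

variable {L : Type*} [Field L] [ValuativeRel L] [TopologicalSpace L] [IsNonarchimedeanLocalField L]

theorem mem_primePow_iff {ϖ : 𝒪[L]} (hϖ : Irreducible ϖ) (n : ℤ) (x : L) :
    x ∈ (primePow L n : Set L) ↔ ∃ y : 𝒪[L], x = (ϖ : L) ^ n * y := by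
  have hϖ0 : (ϖ : L) ≠ 0 := by simpa using hϖ.ne_zero
  have h : primePow L n = FractionalIdeal.spanSingleton 𝒪[L]⁰ ((ϖ : L) ^ n) := by
    have hz : (FractionalIdeal.spanSingleton 𝒪[L]⁰ (ϖ : L)) ≠ 0 := by
      simpa [FractionalIdeal.spanSingleton_ne_zero_iff] using hϖ.ne_zero
    have h1 : (𝓂[L] : FractionalIdeal 𝒪[L]⁰ L) = FractionalIdeal.spanSingleton 𝒪[L]⁰ (ϖ : L) := by
      rw [hϖ.maximalIdeal_eq, FractionalIdeal.coeIdeal_span_singleton]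
      rfl
    rw [primePow, h1]
    obtain ⟨m, rfl | rfl⟩ := n.eq_nat_or_neg
    · rw [zpow_natCast, zpow_natCast, FractionalIdeal.spanSingleton_pow]
    · rw [zpow_neg, zpow_neg, zpow_natCast, zpow_natCast, FractionalIdeal.spanSingleton_pow,
        FractionalIdeal.spanSingleton_inv]
  rw [h]
  refine (FractionalIdeal.mem_spanSingleton _).trans (exists_congr fun y => ?_)
  rw [eq_comm, mul_comm]
  rfl

theorem mem_primePow_iff_valuation {ϖ : 𝒪[L]} (hϖ : Irreducible ϖ) (n : ℤ) (x : L) :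
    x ∈ (primePow L n : Set L) ↔ valuation L x ≤ valuation L (ϖ : L) ^ n := by
  have hϖ0 : (ϖ : L) ≠ 0 := by simpa using hϖ.ne_zero
  have hv0 : 0 < valuation L (ϖ : L) ^ n := zpow_pos (zero_lt_iff.2 (by simpa using hϖ0)) n
  rw [mem_primePow_iff hϖ]
  constructor
  · rintro ⟨y, rfl⟩
    rw [map_mul, map_zpow₀]
    exact mul_le_of_le_one_right' y.2
  · intro h
    refine ⟨⟨x / (ϖ : L) ^ n, ?_⟩, ?_⟩
    · rw [Valuation.mem_integer_iff, map_div₀, map_zpow₀]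
      exact div_le_one_of_le₀ h zero_le
    · exact (mul_div_cancel₀ _ (zpow_ne_zero n hϖ0)).symm

end PrimePow

/-! ### Group ring action and free generators -/

section GroupRing

variable {K L : Type*} [Field K] [ValuativeRel K] [Field L] [Algebra K L]

theorem groupRingAction_single (σ : Gal(L/K)) (r : 𝒪[K]) (x : L) :
    groupRingAction K L (MonoidAlgebra.single σ r) x = (r : K) • σ x := by
  rw [groupRingAction, Representation.asAlgebraHom_single]
  rfl

theorem groupRingAction_eq_sum [FiniteDimensional K L] (a : MonoidAlgebra 𝒪[K] Gal(L/K)) (x : L) :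
    groupRingAction K L a x = ∑ σ : Gal(L/K), (a.coeff σ : K) • σ x := by
  classical
  induction a using MonoidAlgebra.induction_linear with
  | zero => simp
  | add a b ha hb => simp [ha, hb, add_smul, Finset.sum_add_distrib]
  | single σ r =>
    rw [groupRingAction_single, Finset.sum_eq_single σ]
    · simp
    · intro τ _ hτ
      simp [Finsupp.single_eq_of_ne hτ]
    · simp

theorem groupRingAction_injective [FiniteDimensional K L] {x : L}
    (hx : LinearIndependent K fun σ : Gal(L/K) => σ x) :
    Function.Injective fun a => groupRingAction K L a x := by
  intro a b hab
  have h : ∑ σ : Gal(L/K), ((a.coeff σ : K) - b.coeff σ) • σ x = 0 := by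
    simp_rw [sub_smul, Finset.sum_sub_distrib, ← groupRingAction_eq_sum]
    exact sub_eq_zero.2 hab
  ext σ
  exact sub_eq_zero.1 (Fintype.linearIndependent_iff.1 hx _ h σ)

end GroupRing

section Generator

variable {K L : Type*} [Field K] [ValuativeRel K] [TopologicalSpace K] [IsNonarchimedeanLocalField K]
  [Field L] [ValuativeRel L] [TopologicalSpace L] [IsNonarchimedeanLocalField L]
  [Algebra K L] [ValuativeExtension K L]

theorem exists_smul_mem_primePow (n : ℤ) (x : L) :
    ∃ c : K, c ≠ 0 ∧ c • x ∈ (primePow L n : Set L) := by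
  rcases eq_or_ne x 0 with rfl | hx
  · exact ⟨1, one_ne_zero, by rw [smul_zero]; exact Submodule.zero_mem (primePow L n : Submodule 𝒪[L] L)⟩
  obtain ⟨ϖ, hϖ⟩ := IsDiscreteValuationRing.exists_irreducible 𝒪[L]
  obtain ⟨π, hπ⟩ := IsDiscreteValuationRing.exists_irreducible 𝒪[K]
  have hv0 : 0 < valuation L (ϖ : L) := Valuation.integer.v_irreducible_pos hϖ
  have hv1 : valuation L (ϖ : L) < 1 := Valuation.integer.v_irreducible_lt_one hϖ
  have hπ0 : (π : K) ≠ 0 := by simpa using hπ.ne_zero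
  obtain ⟨k, hk⟩ := exists_valuation_eq_zpow hϖ hx
  have hπ1 : valuation L (algebraMap K L π) ≤ valuation L (ϖ : L) := by
    rw [← valuation_lt_one_iff hϖ]
    exact (Valuation.HasExtension.val_map_lt_one_iff (valuation K) (valuation L) _).2
      (Valuation.integer.v_irreducible_lt_one hπ)
  -- Each factor `π` raises the order of `x`, initially `k`, by at least one; if `k ≥ n` the
  -- truncated exponent is `0` and nothing is needed.
  refine ⟨(π : K) ^ (n - k).toNat, pow_ne_zero _ hπ0, ?_⟩
  rw [mem_primePow_iff_valuation hϖ, Algebra.smul_def, map_mul, map_pow, map_pow, hk]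
  calc valuation L (algebraMap K L π) ^ (n - k).toNat * valuation L (ϖ : L) ^ k
      ≤ valuation L (ϖ : L) ^ (n - k).toNat * valuation L (ϖ : L) ^ k := by gcongr
    _ = valuation L (ϖ : L) ^ (((n - k).toNat : ℤ) + k) := by
      rw [zpow_add₀ hv0.ne', zpow_natCast]
    _ ≤ valuation L (ϖ : L) ^ n := zpow_le_zpow_right_of_le_one₀ hv0 hv1.le (by lia)

/-- An element whose Galois module is a full fractional ideal is a free generator. -/
theorem isFreeGenerator_of_range_eq [FiniteDimensional K L] [IsGalois K L] {n : ℤ} {x : L}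
    (h : Set.range (fun a => groupRingAction K L a x) = primePow L n) :
    IsFreeGenerator K (primePow L n : Set L) x := by
  refine ⟨groupRingAction_injective ?_, h⟩
  -- Every element of `L` scales into `𝔓_L^n`, so the conjugates of `x` span `L` over `K`; their
  -- number is `[L:K]`, so they form a basis.
  refine linearIndependent_of_top_le_span_of_card_eq_finrank (fun y _ => ?_) ?_
  · obtain ⟨c, hc, hy⟩ := exists_smul_mem_primePow (K := K) n y
    rw [← h] at hy
    obtain ⟨a, ha⟩ := hy
    rw [← inv_smul_smul₀ hc y, ← ha]
    simp only [groupRingAction_eq_sum]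
    exact Submodule.smul_mem _ _ (Submodule.sum_mem _ fun σ _ =>
      Submodule.smul_mem _ _ (Submodule.subset_span ⟨σ, rfl⟩))
  · rw [← Nat.card_eq_fintype_card, IsGalois.card_aut_eq_finrank]

theorem irreducible_algebraMap_integer (h : Ideal.map (algebraMap 𝒪[K] 𝒪[L]) 𝓂[K] = 𝓂[L])
    {ϖ : 𝒪[K]} (hϖ : Irreducible ϖ) : Irreducible (algebraMap 𝒪[K] 𝒪[L] ϖ) := by
  rw [IsDiscreteValuationRing.irreducible_iff_uniformizer, ← h, hϖ.maximalIdeal_eq, Ideal.map_span,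
    Set.image_singleton]

/-- The trace of an unramified extension maps `𝔓_L^n` onto `𝔓_K^n`. -/
theorem image_trace_primePow [FiniteDimensional K L]
    (h : Ideal.map (algebraMap 𝒪[K] 𝒪[L]) 𝓂[K] = 𝓂[L]) (n : ℤ) :
    Algebra.trace K L '' (primePow L n : Set L) = (primePow K n : Set K) := by
  obtain ⟨ϖ, hϖ⟩ := IsDiscreteValuationRing.exists_irreducible 𝒪[K]
  have hϖL := irreducible_algebraMap_integer h hϖ
  -- A uniformizer of `K` serves for `L` too, so its power comes out of the trace and the claim
  -- reduces to `n = 0`.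
  have key (y : L) : Algebra.trace K L (((algebraMap 𝒪[K] 𝒪[L] ϖ : 𝒪[L]) : L) ^ n * y) =
      (ϖ : K) ^ n * Algebra.trace K L y := by
    rw [Valuation.HasExtension.val_algebraMap, ← map_zpow₀, ← Algebra.smul_def, map_smul,
      smul_eq_mul]
  ext x
  rw [mem_primePow_iff hϖ]
  constructor
  · rintro ⟨y, hy, rfl⟩
    obtain ⟨z, rfl⟩ := (mem_primePow_iff hϖL n y).1 hy
    have := finite_integer K L
    have : Module.Free 𝒪[K] 𝒪[L] := Module.free_of_finite_type_torsion_free'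
    exact ⟨Algebra.trace 𝒪[K] 𝒪[L] z, by rw [key, trace_integer]⟩
  · rintro ⟨y, rfl⟩
    obtain ⟨z, hz⟩ := exists_trace_integer_eq h y
    exact ⟨_, (mem_primePow_iff hϖL n _).2 ⟨z, rfl⟩, by rw [key, hz]⟩

end Generator

/-! ### The trace and restriction of group rings -/

section Trace

variable {K L M : Type*} [Field K] [ValuativeRel K] [Field L] [Field M]
  [Algebra K L] [Algebra K M] [Algebra L M] [IsScalarTower K L M] [Normal K L]

omit [ValuativeRel K] in
theorem trace_algEquiv_apply (σ : Gal(M/K)) (x : M) :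
    Algebra.trace L M (σ x) = AlgEquiv.restrictNormalHom L σ (Algebra.trace L M x) := by
  have h := Algebra.trace_eq_of_equiv_equiv (AlgEquiv.restrictNormalHom L σ).toRingEquiv
    σ.toRingEquiv (RingHom.ext fun y => σ.restrictNormal_commutes L y) x
  rw [h]
  exact ((AlgEquiv.restrictNormalHom L σ).apply_symm_apply _).symm

theorem trace_groupRingAction (a : MonoidAlgebra 𝒪[K] Gal(M/K)) (x : M) :
    Algebra.trace L M (groupRingAction K M a x) =
      groupRingAction K L (MonoidAlgebra.mapDomain (AlgEquiv.restrictNormalHom L) a)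
        (Algebra.trace L M x) := by
  induction a using MonoidAlgebra.induction_linear with
  | zero => simp
  | add a b ha hb => simp [ha, hb, MonoidAlgebra.mapDomain_add]
  | single σ r =>
    rw [MonoidAlgebra.mapDomain_single, groupRingAction_single, groupRingAction_single,
      LinearMap.map_smul_of_tower, trace_algEquiv_apply]

/-- Automorphisms of `L` extend to `M`, so the group ring of `Gal(M/K)` surjects onto that of
`Gal(L/K)`. -/
theorem range_groupRingAction_trace [Normal K M] (x : M) :
    Set.range (fun a => groupRingAction K L a (Algebra.trace L M x)) =
      Algebra.trace L M '' Set.range (fun a => groupRingAction K M a x) := by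
  have hsurj : Function.Surjective
      (MonoidAlgebra.mapDomain (R := 𝒪[K]) (AlgEquiv.restrictNormalHom (F := K) (K₁ := M) L)) :=
    fun b => by
      obtain ⟨a, ha⟩ := Finsupp.mapDomain_surjective
        (AlgEquiv.restrictNormalHom_surjective (F := K) (K₁ := L) M) b.coeff
      exact ⟨.ofCoeff a, MonoidAlgebra.coeff_injective ha⟩
  rw [← Set.range_comp, ← hsurj.range_comp]
  congr 1
  ext a
  exact (trace_groupRingAction a x).symm

end Trace

/-! ### Composita -/

section Compositum

variable {K L K' L' : Type*} [Field K] [Field L] [Field K'] [Field L']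
  [Algebra K L] [Algebra K K'] [Algebra K L'] [Algebra L L'] [IsScalarTower K L L']
  [Algebra K' L'] [IsScalarTower K K' L']

theorem finiteDimensional_of_compositum [FiniteDimensional K L] [FiniteDimensional K K']
    (h : (IsScalarTower.toAlgHom K L L').fieldRange ⊔
      (IsScalarTower.toAlgHom K K' L').fieldRange = ⊤) : FiniteDimensional K L' := by
  have : FiniteDimensional K (⊤ : IntermediateField K L') := by
    rw [← h]
    have h1 : FiniteDimensional K (IsScalarTower.toAlgHom K L L').fieldRange :=
      (AlgEquiv.ofInjectiveField (IsScalarTower.toAlgHom K L L')).toLinearEquiv.finiteDimensional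
    have h2 : FiniteDimensional K (IsScalarTower.toAlgHom K K' L').fieldRange :=
      (AlgEquiv.ofInjectiveField (IsScalarTower.toAlgHom K K' L')).toLinearEquiv.finiteDimensional
    infer_instance
  exact IntermediateField.topEquiv.toLinearEquiv.finiteDimensional

theorem isGalois_of_compositum [IsGalois K L] [IsGalois K K']
    (h : (IsScalarTower.toAlgHom K L L').fieldRange ⊔
      (IsScalarTower.toAlgHom K K' L').fieldRange = ⊤) : IsGalois K L' := by
  have : IsGalois K (⊤ : IntermediateField K L') := by
    rw [← h]
    have h1 : IsGalois K (IsScalarTower.toAlgHom K L L').fieldRange :=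
      IsGalois.of_algEquiv (AlgEquiv.ofInjectiveField (IsScalarTower.toAlgHom K L L'))
    have h2 : IsGalois K (IsScalarTower.toAlgHom K K' L').fieldRange :=
      IsGalois.of_algEquiv (AlgEquiv.ofInjectiveField (IsScalarTower.toAlgHom K K' L'))
    have := h1.to_isSeparable
    have := h2.to_isSeparable
    exact ⟨⟩
  exact IsGalois.of_algEquiv IntermediateField.topEquiv

/-- The fixed field of `⟨σ⟩` contains both factors, hence their compositum. -/
theorem eq_one_of_compositum
    (h : (IsScalarTower.toAlgHom K L L').fieldRange ⊔
      (IsScalarTower.toAlgHom K K' L').fieldRange = ⊤) {σ : Gal(L'/K)}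
    (hL : ∀ x : L, σ (algebraMap L L' x) = algebraMap L L' x)
    (hK' : ∀ x : K', σ (algebraMap K' L' x) = algebraMap K' L' x) : σ = 1 := by
  have hle : (⊤ : IntermediateField K L') ≤
      IntermediateField.fixedField (Subgroup.zpowers σ) := by
    have hfix (x : L') (hx : σ x = x) :
        x ∈ IntermediateField.fixedField (Subgroup.zpowers σ) := by
      have : Subgroup.zpowers σ ≤ MulAction.stabilizer Gal(L'/K) x := by
        rw [Subgroup.zpowers_le]
        exact hx
      exact fun g => this g.2
    rw [← h]
    refine sup_le ?_ ?_
    · rintro _ ⟨x, rfl⟩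
      exact hfix _ (hL x)
    · rintro _ ⟨x, rfl⟩
      exact hfix _ (hK' x)
  ext x
  exact hle (x := x) trivial ⟨σ, Subgroup.mem_zpowers σ⟩

theorem restrictNormalHom_eq_one_iff [Normal K L] (σ : Gal(L'/K)) :
    AlgEquiv.restrictNormalHom L σ = 1 ↔
      ∀ x : L, σ (algebraMap L L' x) = algebraMap L L' x := by
  rw [AlgEquiv.ext_iff]
  refine forall_congr' fun x => ?_
  rw [← (algebraMap L L').injective.eq_iff]
  change algebraMap L L' (σ.restrictNormal L x) = _ ↔ _
  rw [AlgEquiv.restrictNormal_commutes]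
  rfl

end Compositum

/-! ### Ramification groups under restriction -/

section Unramified

variable {K L M : Type*}
  [Field K] [ValuativeRel K] [TopologicalSpace K] [IsNonarchimedeanLocalField K]
  [Field L] [ValuativeRel L] [TopologicalSpace L] [IsNonarchimedeanLocalField L]
  [Field M] [ValuativeRel M] [TopologicalSpace M] [IsNonarchimedeanLocalField M]
  [Algebra K L] [ValuativeExtension K L] [Algebra K M] [ValuativeExtension K M]
  [Algebra L M] [IsScalarTower K L M] [ValuativeExtension L M]

/-- A uniformizer of `L` is one of `M`, so the congruence for `σ` on integers of `L` has the same
exponent in both fields. -/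
theorem restrictNormalHom_mem_ramificationGroup [Normal K L]
    (h : Ideal.map (algebraMap 𝒪[L] 𝒪[M]) 𝓂[L] = 𝓂[M]) {σ : Gal(M/K)} {i : ℕ}
    (hσ : σ ∈ ramificationGroup K M i) :
    AlgEquiv.restrictNormalHom L σ ∈ ramificationGroup K L i := by
  obtain ⟨ϖ, hϖ⟩ := IsDiscreteValuationRing.exists_irreducible 𝒪[L]
  rw [mem_ramificationGroup_iff hϖ]
  rw [mem_ramificationGroup_iff (irreducible_algebraMap_integer h hϖ)] at hσ
  intro x
  have hx := hσ (algebraMap 𝒪[L] 𝒪[M] x)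
  have hc : algebraMap L M (AlgEquiv.restrictNormalHom L σ x) = σ (algebraMap L M x) :=
    σ.restrictNormal_commutes L x
  rw [Valuation.HasExtension.val_algebraMap, Valuation.HasExtension.val_algebraMap, ← hc,
    ← map_sub, ← map_pow, ← map_pow,
    Valuation.HasExtension.val_map_le_iff (valuation L) (valuation M), map_pow] at hx
  exact hx

end Unramified

end LocalGalois

open LocalGalois

theorem theorem4p2
    {K L K' L' : Type*}
    [Field K] [ValuativeRel K] [TopologicalSpace K] [IsNonarchimedeanLocalField K]
    [Field L] [ValuativeRel L] [TopologicalSpace L] [IsNonarchimedeanLocalField L]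
    [Field K'] [ValuativeRel K'] [TopologicalSpace K'] [IsNonarchimedeanLocalField K']
    [Field L'] [ValuativeRel L'] [TopologicalSpace L'] [IsNonarchimedeanLocalField L']
    [Algebra K L] [ValuativeExtension K L] [FiniteDimensional K L] [IsGalois K L]
    [Algebra K K'] [ValuativeExtension K K']
    [Algebra K L'] [ValuativeExtension K L']
    [Algebra L L'] [IsScalarTower K L L'] [Algebra K' L'] [IsScalarTower K K' L']
    (hweak : LocalGalois.WeaklyRamified K L)
    (hunram : LocalGalois.IsUnramified K K')
    (hdeg : Module.finrank K K' = Module.finrank K L)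
    (hcomp : (IsScalarTower.toAlgHom K L L').fieldRange ⊔
      (IsScalarTower.toAlgHom K K' L').fieldRange = ⊤) :
    FiniteDimensional K L' ∧ IsGalois K L' ∧
      LocalGalois.WeaklyRamified K L' ∧ LocalGalois.DoublySplit K L' ∧
      ∀ n : ℤ, n ≡ 1 [ZMOD Nat.card (LocalGalois.ramificationGroup K L 1)] →
        ∀ ε' : L', LocalGalois.IsFreeGenerator K (LocalGalois.primePow L' n : Set L') ε' →
          LocalGalois.IsFreeGenerator K (LocalGalois.primePow L n : Set L)
            (Algebra.trace L L' ε') := by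
  have : FiniteDimensional K K' :=
    FiniteDimensional.of_finrank_pos (hdeg ▸ Module.finrank_pos)
  have : IsGalois K K' := hunram.isGalois
  have : FiniteDimensional K L' := finiteDimensional_of_compositum hcomp
  have : IsGalois K L' := isGalois_of_compositum hcomp
  have : FiniteDimensional L L' := Module.Finite.of_restrictScalars_finite K L L'
  have : IsGalois L L' := IsGalois.tower_top_of_isGalois K L L'
  have : ValuativeExtension L L' := valuativeExtension_of_isScalarTower K L L'
  have hmap : Ideal.map (algebraMap 𝒪[L] 𝒪[L']) 𝓂[L] = 𝓂[L'] := by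
    refine map_maximalIdeal_eq_of_inertia_eq_bot (eq_bot_iff.2 fun τ hτ => ?_)
    -- The inertia condition does not mention the base field, so `hτ` also places `τ` in the inertia
    -- group over `K`, which fixes `K'`.
    have h1 : τ.restrictScalars K = 1 := eq_one_of_compositum hcomp τ.commutes
      (hunram.apply_algebraMap_eq_self (σ := τ.restrictScalars K) hτ)
    exact AlgEquiv.restrictScalars_injective K h1
  have hweak' : WeaklyRamified K L' := by
    refine eq_bot_iff.2 fun σ hσ => eq_one_of_compositum hcomp ?_
      (hunram.apply_algebraMap_eq_self (ramificationGroup_antitone zero_le_two hσ))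
    rw [← restrictNormalHom_eq_one_iff, ← Subgroup.mem_bot, ← hweak]
    exact restrictNormalHom_mem_ramificationGroup hmap hσ
  refine ⟨‹_›, ‹_›, hweak', hweak'.doublySplit fun σ => ?_, fun n _ ε' hε' => ?_⟩
  -- `Gal(L'/K)` embeds in `Gal(L/K) × Gal(K'/K)`, both of order `[L:K]`. As inertia fixes `K'`, its
  -- index is a multiple of `[K':K] = [L:K]`.
  · have hn : σ ^ Module.finrank K L = 1 := by
      refine eq_one_of_compositum hcomp (K := K) (L := L) (K' := K') ?_ ?_
      · rw [← restrictNormalHom_eq_one_iff, map_pow, ← IsGalois.card_aut_eq_finrank,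
          pow_card_eq_one']
      · rw [← restrictNormalHom_eq_one_iff, map_pow, ← hdeg, ← IsGalois.card_aut_eq_finrank,
          pow_card_eq_one']
    have hle : ramificationGroup K L' 0 ≤
        (AlgEquiv.restrictNormalHom K' : Gal(L'/K) →* Gal(K'/K)).ker := fun τ hτ =>
      (restrictNormalHom_eq_one_iff τ).2 (hunram.apply_algebraMap_eq_self hτ)
    have hdvd := Subgroup.index_dvd_of_le hle
    rw [Subgroup.index_ker, MonoidHom.range_eq_top.2 (AlgEquiv.restrictNormalHom_surjective L'),
      Subgroup.card_top, IsGalois.card_aut_eq_finrank, hdeg] at hdvd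
    obtain ⟨t, ht⟩ := hdvd
    rw [ht, pow_mul, hn, one_pow]
  · refine isFreeGenerator_of_range_eq ?_
    rw [range_groupRingAction_trace, hε'.2, image_trace_primePow hmap]
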